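/- Let $p \in (0,1)$ and let $\xi_1, \xi_2, \dots$ be i.i.d. Bernoulli random variables with $P(\xi_i = 1) = p = 1 - P(\xi_i = 0)$. For $n \ge k \ge 1$ let $W_n(k) = \sum_{i=0}^{n-k} \mathbb{I}\{A_i\}$ be the number of head runs of length at least $k$ among $\xi_1, \dots, \xi_n$, where $A_0 = \{\xi_1 = \dots = \xi_k = 1\}$ and $A_i = \{\xi_i = 0,\ \xi_{i+1} = \dots = \xi_{i+k} = 1\}$ for $i \ge 1$. Put $\lambda_k = n(1-p)p^k$, and let $\pi_\lambda$ denote a Poisson random variable with parameter $\lambda$. Then for every fixed integer $j \ge 0$, as $n \to \infty$, $$\max_{1 \le k \le n} \bigl| P(W_n(k) = j) - P(\pi_{\lambda_k} = j) \bigr| = O(n^{-1} \ln n).$$ -/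

import Mathlib

open MeasureTheory ProbabilityTheory Filter Asymptotics

section HeadRuns

variable {Ω : Type*}

/-- For a sequence `ξ 1, ξ 2, …` (the value `ξ 0` is never used), the event that a head run
of length at least `k` starts immediately after position `i`. For `i = 0` it is
`{ξ 1 = ⋯ = ξ k = 1}`, and for `i ≥ 1` it is `{ξ i = 0, ξ (i+1) = ⋯ = ξ (i+k) = 1}`. -/
def headRunEvent (ξ : ℕ → Ω → ℕ) (k i : ℕ) : Set Ω :=
  {ω | (1 ≤ i → ξ i ω = 0) ∧ ∀ m ∈ Finset.Icc 1 k, ξ (i + m) ω = 1}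

/-- The number of head runs of length at least `k` among `ξ 1, …, ξ n`:
the sum over `0 ≤ i ≤ n - k` of the indicators of the events `headRunEvent ξ k i`. -/
noncomputable def numHeadRuns (ξ : ℕ → Ω → ℕ) (n k : ℕ) (ω : Ω) : ℕ :=
  ∑ i ∈ Finset.range (n + 1 - k), (headRunEvent ξ k i).indicator (fun _ => 1) ω

end HeadRuns

/-- The Poisson parameter `n (1 - p) p ^ k`, for `p` in the unit interval. -/
noncomputable def headRunRate (p : unitInterval) (n k : ℕ) : NNReal :=
  ⟨(n : ℝ) * (1 - (p : ℝ)) * (p : ℝ) ^ k,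
    mul_nonneg (mul_nonneg n.cast_nonneg (sub_nonneg.2 p.2.2)) (pow_nonneg p.2.1 k)⟩

/-!
Write `W n` for the number of head runs of length at least `k` among the first `n` trials, and
`μ = (1 - p) * p ^ k`. A run reaching length `k` at time `n + 1` occupies the `k + 1` trials after
time `n - k` and starts with a zero, so it is independent of `W (n - k)` and forces
`W n = W (n - k)`. Hence `a j n = P (W n = j)` satisfies, for `n ≥ k`, the recurrence with delay
`a j (n + 1) = a j n - μ * a j (n - k) + μ * a (j - 1) (n - k)`
(`delayedBirth_numHeadRuns`), whereas the Poisson probabilities with parameter `μ n` satisfy the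
same recurrence without delay up to `O(μ ^ 2)` (`abs_poissonWeight_step_le`).

As `W` is nondecreasing, the recurrence is a Grönwall inequality for `P (W n < J)`, which is
therefore at most a polynomial in `μ n` times `exp (-μ n)` (`DelayedBirth.exists_sum_le`). So are
the increments of `a j` divided by `μ`, and since `k μ ≤ 1`, dropping the delay costs only
`k μ ^ 2` times such a weight per step. A second use of Grönwall's inequality, by induction on `j`,
yields `|a j n - Poisson| ≤ C k μ (1 + μ n) ^ (j + 2) exp (-μ n)`
(`DelayedBirth.exists_abs_sub_poissonWeight_le`).

The exponential factor is what makes the logarithm appear to the first power only: the bound is at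
most a constant times `k / n` and at most a constant times `k p ^ k`, and one of the two is
`O(log n / n)` according as `k` is below or above `2 log n / log (1 / p)` (`exists_mul_decay_le`).
-/

/-! ### The weights `(1 + t) ^ m * exp (-t)` -/

/-- The weight `(1 + t) ^ m * exp (-t)`. Every error term below is measured against it at
`t = μ n`; the exponent `m` is allowed to grow with the number of runs and is never optimised. -/
noncomputable def decay (m : ℕ) (t : ℝ) : ℝ := (1 + t) ^ m * Real.exp (-t)

lemma decay_nonneg (m : ℕ) {t : ℝ} (ht : 0 ≤ t) : 0 ≤ decay m t := by
  unfold decay; positivity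

lemma decay_le_decay_of_le {m m' : ℕ} (h : m ≤ m') {t : ℝ} (ht : 0 ≤ t) :
    decay m t ≤ decay m' t := by
  unfold decay
  gcongr
  linarith

lemma exp_one_le_three : Real.exp 1 ≤ 3 := by
  linarith [Real.exp_one_lt_d9]

lemma decay_le_three_mul_decay {m : ℕ} {s t : ℝ} (hs : 0 ≤ s) (hst : s ≤ t) (hts : t ≤ s + 1) :
    decay m s ≤ 3 * decay m t := by
  have h : Real.exp (-s) ≤ 3 * Real.exp (-t) := by
    calc Real.exp (-s) ≤ Real.exp (1 + -t) := Real.exp_le_exp.2 (by linarith)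
      _ = Real.exp 1 * Real.exp (-t) := Real.exp_add _ _
      _ ≤ 3 * Real.exp (-t) := by gcongr; exact exp_one_le_three
  calc decay m s ≤ (1 + t) ^ m * (3 * Real.exp (-t)) := by
        have : 0 ≤ t := hs.trans hst
        unfold decay
        gcongr
    _ = 3 * decay m t := by unfold decay; ring

lemma decay_le_two_pow_mul_decay {m : ℕ} {s t : ℝ} (hs : 0 ≤ s) (hst : s ≤ t) (hts : t ≤ s + 1) :
    decay m t ≤ 2 ^ m * decay m s := by
  calc decay m t ≤ (2 * (1 + s)) ^ m * Real.exp (-s) := by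
        unfold decay
        gcongr
        · linarith
        · linarith
    _ = 2 ^ m * decay m s := by rw [mul_pow, mul_assoc]; rfl

lemma one_le_three_mul_decay (m : ℕ) {t : ℝ} (ht : 0 ≤ t) (ht1 : t ≤ 1) :
    1 ≤ 3 * decay m t := by
  simpa [decay] using decay_le_three_mul_decay (m := m) le_rfl ht (by linarith)

/-- A polynomial times `exp (-t)` is bounded on `[0, ∞)`. -/
lemma decay_le_factorial (m : ℕ) {t : ℝ} (ht : 0 ≤ t) : decay m t ≤ 3 * m.factorial := by
  have h := Real.pow_div_factorial_le_exp (1 + t) (by linarith) m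
  rw [div_le_iff₀ (by positivity)] at h
  calc decay m t ≤ Real.exp (1 + t) * m.factorial * Real.exp (-t) := by unfold decay; gcongr
    _ = Real.exp 1 * m.factorial := by
        rw [mul_right_comm, ← Real.exp_add, add_neg_cancel_right]
    _ ≤ 3 * m.factorial := by gcongr; exact exp_one_le_three

/-- Discrete Grönwall inequality. The factor `1 - μ ≤ exp (-μ)` reproduces the exponential decay,
and summing the forcing over `n` steps costs one power of `1 + μ n`. -/
lemma le_mul_decay_of_recurrence {μ D K : ℝ} {m n₀ : ℕ} {u : ℕ → ℝ} (hμ0 : 0 ≤ μ) (hμ1 : μ ≤ 1)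
    (hD : 0 ≤ D) (hK : 0 ≤ K) (h0 : u n₀ ≤ D * decay m (μ * n₀))
    (hs : ∀ n, n₀ ≤ n → u (n + 1) ≤ (1 - μ) * u n + K * μ * decay m (μ * n)) (n : ℕ)
    (hn : n₀ ≤ n) : u n ≤ (D + 3 * K) * decay (m + 1) (μ * n) := by
  have key : u n ≤ (D + 3 * K * (μ * n)) * decay m (μ * n) := by
    induction n, hn using Nat.le_induction with
    | base =>
      refine h0.trans ?_
      have := decay_nonneg m (t := μ * n₀) (by positivity)
      gcongr
      have : 0 ≤ 3 * K * (μ * n₀) := by positivity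
      linarith
    | succ n hn ih =>
      have hb : 0 ≤ D + 3 * K * (μ * n) := by positivity
      have hexp : Real.exp (-(μ * (n + 1 : ℕ))) = Real.exp (-μ) * Real.exp (-(μ * n)) := by
        rw [← Real.exp_add]; push_cast; ring_nf
      have h1 : 1 - μ ≤ Real.exp (-μ) := by linarith [Real.add_one_le_exp (-μ)]
      have h3 : 1 ≤ 3 * Real.exp (-μ) := by
        simpa [decay] using one_le_three_mul_decay 0 hμ0 hμ1
      have hpow : (1 + μ * n) ^ m ≤ (1 + μ * (n + 1 : ℕ)) ^ m := by
        gcongr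
        simp
      have hw : Real.exp (-μ) * decay m (μ * n) ≤ decay m (μ * (n + 1 : ℕ)) := by
        unfold decay
        rw [hexp]
        have : 0 ≤ Real.exp (-μ) * Real.exp (-(μ * n)) := by positivity
        nlinarith
      have hd := decay_nonneg m (t := μ * n) (by positivity)
      calc u (n + 1) ≤ (1 - μ) * u n + K * μ * decay m (μ * n) := hs n hn
        _ ≤ (1 - μ) * ((D + 3 * K * (μ * n)) * decay m (μ * n)) + K * μ * decay m (μ * n) := by
            gcongr
        _ ≤ Real.exp (-μ) * ((D + 3 * K * (μ * n)) * decay m (μ * n))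
              + K * μ * (3 * Real.exp (-μ)) * decay m (μ * n) := by
            refine add_le_add (by gcongr) (mul_le_mul_of_nonneg_right ?_ hd)
            exact le_mul_of_one_le_right (by positivity) h3
        _ = (D + 3 * K * (μ * (n + 1 : ℕ))) * (Real.exp (-μ) * decay m (μ * n)) := by
            push_cast; ring
        _ ≤ (D + 3 * K * (μ * (n + 1 : ℕ))) * decay m (μ * (n + 1 : ℕ)) := by gcongr
  refine key.trans ?_
  have hd := decay_nonneg m (t := μ * n) (by positivity)
  have hx : 0 ≤ μ * n := by positivity
  calc (D + 3 * K * (μ * n)) * decay m (μ * n)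
      ≤ ((D + 3 * K) * (1 + μ * n)) * decay m (μ * n) := by
        gcongr
        nlinarith [mul_nonneg hD hx]
    _ = (D + 3 * K) * decay (m + 1) (μ * n) := by unfold decay; ring

/-- Increments bounded by `C μ decay m (μ n)` sum to `O(k μ)` times the same weight over at most
`k` steps when `k μ ≤ 1`, because the weight varies by a bounded factor over such a stretch. -/
lemma abs_sub_le_of_increments {C μ : ℝ} {k m : ℕ} {x : ℕ → ℝ} (hC : 0 ≤ C) (hμ0 : 0 ≤ μ)
    (hkμ : k * μ ≤ 1) (hx : ∀ n : ℕ, |x (n + 1) - x n| ≤ C * μ * decay m (μ * n))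
    (n d : ℕ) (hd : d ≤ k) :
    |x (n + d) - x n| ≤ 3 * C * (k * μ) * decay m (μ * (n + d : ℕ)) := by
  have hd' : (d : ℝ) ≤ k := by exact_mod_cast hd
  have hw := decay_nonneg m (t := μ * (n + d : ℕ)) (by positivity)
  have htel : x (n + d) - x n = ∑ i ∈ Finset.range d, (x (n + i + 1) - x (n + i)) :=
    (Finset.sum_range_sub (fun i => x (n + i)) d).symm
  rw [htel]
  calc |∑ i ∈ Finset.range d, (x (n + i + 1) - x (n + i))|
      ≤ ∑ i ∈ Finset.range d, |x (n + i + 1) - x (n + i)| := Finset.abs_sum_le_sum_abs _ _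
    _ ≤ ∑ i ∈ Finset.range d, C * μ * (3 * decay m (μ * (n + d : ℕ))) := by
        refine Finset.sum_le_sum fun i hi => (hx (n + i)).trans ?_
        have hid : (i : ℝ) ≤ d := by exact_mod_cast (Finset.mem_range.1 hi).le
        gcongr
        refine decay_le_three_mul_decay (by positivity) ?_ ?_
        · push_cast; gcongr
        · push_cast; nlinarith
    _ = d * (3 * C * μ * decay m (μ * (n + d : ℕ))) := by
        rw [Finset.sum_const, Finset.card_range, nsmul_eq_mul]; ring
    _ ≤ k * (3 * C * μ * decay m (μ * (n + d : ℕ))) := by gcongr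
    _ = _ := by ring

/-! ### The Poisson probabilities -/

/-- The sequence `a` with its first index lowered by one, and `0` for the missing entry `a (-1)`. -/
def prev {α : Type*} (a : ℕ → α → ℝ) : ℕ → α → ℝ
  | 0, _ => 0
  | j + 1, t => a j t

/-- The Poisson probability `exp (-t) * t ^ j / j!`. -/
noncomputable def poissonWeight (j : ℕ) (t : ℝ) : ℝ := Real.exp (-t) * t ^ j / j.factorial

lemma hasDerivAt_poissonWeight (j : ℕ) (t : ℝ) :
    HasDerivAt (poissonWeight j) (prev poissonWeight j t - poissonWeight j t) t := by
  have he : HasDerivAt (fun t : ℝ => Real.exp (-t)) (Real.exp (-t) * -1) t :=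
    (hasDerivAt_neg t).exp
  have h := (he.mul (hasDerivAt_pow j t)).div_const (j.factorial : ℝ)
  refine h.congr_deriv ?_
  cases j with
  | zero => simp [prev, poissonWeight]
  | succ j =>
    have : (j.factorial : ℝ) ≠ 0 := by positivity
    simp only [prev, poissonWeight, Nat.factorial_succ]
    push_cast
    field_simp
    ring

lemma poissonWeight_nonneg (j : ℕ) {t : ℝ} (ht : 0 ≤ t) : 0 ≤ poissonWeight j t := by
  unfold poissonWeight; positivity

lemma poissonWeight_le_decay (j : ℕ) {t : ℝ} (ht : 0 ≤ t) : poissonWeight j t ≤ decay j t := by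
  unfold poissonWeight decay
  rw [mul_comm]
  refine (div_le_self (by positivity) (by exact_mod_cast j.factorial_pos)).trans ?_
  gcongr
  linarith

lemma prev_poissonWeight_nonneg (j : ℕ) {t : ℝ} (ht : 0 ≤ t) : 0 ≤ prev poissonWeight j t := by
  cases j with
  | zero => exact le_rfl
  | succ j => exact poissonWeight_nonneg j ht

lemma prev_poissonWeight_le_decay (j : ℕ) {t : ℝ} (ht : 0 ≤ t) :
    prev poissonWeight j t ≤ decay j t := by
  cases j with
  | zero => exact decay_nonneg 0 ht
  | succ j => exact (poissonWeight_le_decay j ht).trans (decay_le_decay_of_le j.le_succ ht)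

lemma abs_poissonWeight_sub_le (j : ℕ) {s t : ℝ} (hs : 0 ≤ s) (hst : s ≤ t) (hts : t ≤ s + 1) :
    |poissonWeight j t - poissonWeight j s| ≤ 2 ^ j * decay j s * (t - s) := by
  refine norm_image_sub_le_of_norm_deriv_le_segment' (f := poissonWeight j)
    (fun x _ => (hasDerivAt_poissonWeight j x).hasDerivWithinAt) (fun x hx => ?_) t ⟨hst, le_rfl⟩
  have hx0 : 0 ≤ x := hs.trans hx.1
  have h1 := poissonWeight_nonneg j hx0
  have h2 := poissonWeight_le_decay j hx0
  have h3 := prev_poissonWeight_nonneg j hx0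
  have h4 := prev_poissonWeight_le_decay j hx0
  have h5 : decay j x ≤ 2 ^ j * decay j s :=
    decay_le_two_pow_mul_decay hs hx.1 (hx.2.le.trans hts)
  rw [Real.norm_eq_abs, abs_le]
  constructor <;> linarith

lemma abs_prev_poissonWeight_sub_le (j : ℕ) {s t : ℝ} (hs : 0 ≤ s) (hst : s ≤ t)
    (hts : t ≤ s + 1) :
    |prev poissonWeight j t - prev poissonWeight j s| ≤ 2 ^ j * decay j s * (t - s) := by
  have h0 : 0 ≤ t - s := sub_nonneg.2 hst
  cases j with
  | zero =>
    have := decay_nonneg 0 hs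
    simp only [prev, sub_self, abs_zero]
    positivity
  | succ j =>
    refine (abs_poissonWeight_sub_le j hs hst hts).trans ?_
    have := decay_nonneg j hs
    gcongr
    · norm_num
    · omega
    · exact decay_le_decay_of_le j.le_succ hs

/-- The Poisson probabilities satisfy the delay-free recurrence up to `O(μ²)`, by a first order
Taylor expansion of `poissonWeight j` at `s`. -/
lemma abs_poissonWeight_step_le (j : ℕ) {s μ : ℝ} (hs : 0 ≤ s) (hμ0 : 0 ≤ μ) (hμ1 : μ ≤ 1) :
    |poissonWeight j (s + μ) - ((1 - μ) * poissonWeight j s + μ * prev poissonWeight j s)|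
      ≤ 2 * 2 ^ j * decay j s * μ ^ 2 := by
  set c := prev poissonWeight j s - poissonWeight j s with hc
  have h := norm_image_sub_le_of_norm_deriv_le_segment' (a := s) (b := s + μ)
    (f := fun x => poissonWeight j x - x * c) (C := 2 * (2 ^ j * decay j s * μ))
    (fun x _ => ((hasDerivAt_poissonWeight j x).sub
      ((hasDerivAt_id x).mul_const c)).hasDerivWithinAt) (fun x hx => ?_) (s + μ)
    ⟨by linarith, le_rfl⟩
  · rw [Real.norm_eq_abs] at h
    calc _ = |poissonWeight j (s + μ) - (s + μ) * c - (poissonWeight j s - s * c)| := by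
          congr 1; rw [hc]; ring
      _ ≤ _ := h
      _ = _ := by ring
  · have h1 := abs_poissonWeight_sub_le j hs hx.1 (by linarith [hx.2])
    have h2 := abs_prev_poissonWeight_sub_le j hs hx.1 (by linarith [hx.2])
    have h3 : 2 ^ j * decay j s * (x - s) ≤ 2 ^ j * decay j s * μ := by
      have := decay_nonneg j hs
      gcongr
      linarith [hx.2]
    rw [Real.norm_eq_abs]
    rw [abs_le] at *
    constructor <;> linarith [h1.1, h1.2, h2.1, h2.2]

/-! ### Pure birth chains with delay -/

/-- The probabilities `a j n` that a counting process equals `j` at time `n`, where the process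
is `0` before time `k`, makes its first possible jump at time `k` with probability at most `B μ`,
and from then on jumps at time `n + 1` with probability `μ` independently of its value at time
`n - k`, no jump having occurred in between. The case of head runs has `μ = (1 - p) * p ^ k`
and `B = 1 / (1 - p)`. -/
structure DelayedBirth (B μ : ℝ) (k : ℕ) (a : ℕ → ℕ → ℝ) : Prop where
  nonneg : ∀ j n, 0 ≤ a j n
  eq_of_lt : ∀ j n, n < k → a j n = if j = 0 then 1 else 0
  first_jump : ∀ j n, n + 1 = k → |a j (n + 1) - a j n| ≤ B * μ
  recurrence : ∀ j n, k ≤ n → a j (n + 1) = a j n - μ * a j (n - k) + μ * prev a j (n - k)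
  /-- The process is nondecreasing. -/
  sum_antitone : ∀ J, Antitone fun n => ∑ j ∈ Finset.range J, a j n
  sum_le_one : ∀ J n, ∑ j ∈ Finset.range J, a j n ≤ 1
  pos : 1 ≤ k
  rate_nonneg : 0 ≤ μ
  delay_mul_rate_le : k * μ ≤ 1

lemma sum_range_succ_prev (a : ℕ → ℕ → ℝ) (J n : ℕ) :
    ∑ j ∈ Finset.range (J + 1), prev a j n = ∑ j ∈ Finset.range J, a j n := by
  rw [Finset.sum_range_succ']
  simp [prev]

namespace DelayedBirth

variable {B μ : ℝ} {k : ℕ} {a : ℕ → ℕ → ℝ}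

lemma rate_le_one (h : DelayedBirth B μ k a) : μ ≤ 1 := by
  have h1 : (1 : ℝ) ≤ k := by exact_mod_cast h.pos
  nlinarith [h.rate_nonneg, h.delay_mul_rate_le]

lemma rate_le_delay_mul_rate (h : DelayedBirth B μ k a) : μ ≤ k * μ := by
  have h1 : (1 : ℝ) ≤ k := by exact_mod_cast h.pos
  nlinarith [h.rate_nonneg]

lemma prev_nonneg (h : DelayedBirth B μ k a) (j n : ℕ) : 0 ≤ prev a j n := by
  cases j with
  | zero => exact le_rfl
  | succ j => exact h.nonneg j n

lemma one_le_decay (h : DelayedBirth B μ k a) (m : ℕ) {n : ℕ} (hn : n ≤ k) :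
    1 ≤ 3 * decay m (μ * n) := by
  have h0 := h.rate_nonneg
  have hn' : (n : ℝ) ≤ k := by exact_mod_cast hn
  refine one_le_three_mul_decay m (by positivity) ?_
  nlinarith [h.delay_mul_rate_le]

lemma decay_sub_le (h : DelayedBirth B μ k a) (m n : ℕ) (hn : k ≤ n) :
    decay m (μ * (n - k : ℕ)) ≤ 3 * decay m (μ * n) := by
  have h0 := h.rate_nonneg
  refine decay_le_three_mul_decay (by positivity) ?_ ?_
  · gcongr
    omega
  · rw [Nat.cast_sub hn]
    nlinarith [h.delay_mul_rate_le]

/-- Exponential decay of the lower tail. Monotonicity replaces the delayed tail sum in the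
recurrence by the present one, which turns it into a Grönwall inequality, for induction on `J`. -/
lemma exists_sum_le (B : ℝ) (J : ℕ) : ∃ C, 0 ≤ C ∧ ∀ {μ : ℝ} {k : ℕ} {a : ℕ → ℕ → ℝ},
    DelayedBirth B μ k a → ∀ n : ℕ, ∑ j ∈ Finset.range J, a j n ≤ C * decay J (μ * n) := by
  induction J with
  | zero => exact ⟨0, le_rfl, fun _ n => by simp⟩
  | succ J ih =>
    obtain ⟨C, hC, ih⟩ := ih
    refine ⟨1 + 3 * (3 * C + 3), by positivity, fun {μ k a} h n => ?_⟩
    have h0 := h.rate_nonneg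
    refine le_mul_decay_of_recurrence (n₀ := 0)
      (u := fun n => ∑ j ∈ Finset.range (J + 1), a j n) h0 h.rate_le_one zero_le_one
      (by positivity) ?_ (fun n _ => ?_) n n.zero_le
    · simpa [decay] using h.sum_le_one (J + 1) 0
    have hd := decay_nonneg J (t := μ * n) (by positivity)
    obtain hn | hn := lt_or_ge n k
    · have h1 : ∑ j ∈ Finset.range (J + 1), a j n = 1 := by
        simp [h.eq_of_lt _ n hn]
      have h2 := h.sum_le_one (J + 1) (n + 1)
      have h3 := mul_le_mul_of_nonneg_left (h.one_le_decay J hn.le) h0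
      have h4 : 0 ≤ C * (μ * decay J (μ * n)) := by positivity
      simp only [h1]
      linarith
    · have h1 : ∑ j ∈ Finset.range (J + 1), a j (n + 1) =
          ∑ j ∈ Finset.range (J + 1), a j n - μ * ∑ j ∈ Finset.range (J + 1), a j (n - k)
            + μ * ∑ j ∈ Finset.range J, a j (n - k) := by
        rw [Finset.sum_congr rfl fun j _ => h.recurrence j n hn, Finset.sum_add_distrib,
          Finset.sum_sub_distrib, ← Finset.mul_sum, ← Finset.mul_sum, sum_range_succ_prev]
      have h2 := mul_le_mul_of_nonneg_left (h.sum_antitone (J + 1) (n.sub_le k)) h0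
      have h3 : μ * ∑ j ∈ Finset.range J, a j (n - k) ≤ μ * (C * (3 * decay J (μ * n))) := by
        gcongr
        exact (ih h (n - k)).trans (by gcongr; exact h.decay_sub_le J n hn)
      have h4 : 0 ≤ μ * decay J (μ * n) := by positivity
      simp only [h1] at h2 ⊢
      linarith

/-- One step changes each probability by at most `O(μ)` times the weight. -/
lemma exists_increment_le {B : ℝ} (hB : 0 ≤ B) (j : ℕ) :
    ∃ C, 0 ≤ C ∧ ∀ {μ : ℝ} {k : ℕ} {a : ℕ → ℕ → ℝ}, DelayedBirth B μ k a →
      ∀ n : ℕ, |a j (n + 1) - a j n| ≤ C * μ * decay (j + 1) (μ * n) := by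
  obtain ⟨C, hC, hsum⟩ := exists_sum_le B (j + 1)
  refine ⟨3 * B + 3 * C, by positivity, fun {μ k a} h n => ?_⟩
  have h0 := h.rate_nonneg
  have hd := decay_nonneg (j + 1) (t := μ * n) (by positivity)
  have hCd : 0 ≤ C * (μ * decay (j + 1) (μ * n)) := by positivity
  have hBd : 0 ≤ B * (μ * decay (j + 1) (μ * n)) := by positivity
  obtain hn | hn | hn := lt_trichotomy (n + 1) k
  · rw [h.eq_of_lt j _ hn, h.eq_of_lt j n (by omega), sub_self, abs_zero]
    linarith
  · have h1 := h.first_jump j n hn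
    have h2 := mul_le_mul_of_nonneg_left (h.one_le_decay (j + 1) (n := n) (by omega))
      (mul_nonneg hB h0)
    linarith
  · have hn : k ≤ n := by omega
    have h1 := h.nonneg j (n - k)
    have h2 := h.prev_nonneg j (n - k)
    -- The two terms of the recurrence are among the summands of the lower tail.
    have h3 : a j (n - k) ≤ ∑ i ∈ Finset.range (j + 1), a i (n - k) :=
      Finset.single_le_sum (f := fun i => a i (n - k)) (fun i _ => h.nonneg i _)
        (Finset.self_mem_range_succ j)
    have h4 : prev a j (n - k) ≤ ∑ i ∈ Finset.range (j + 1), a i (n - k) := by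
      cases j with
      | zero => exact h1.trans h3
      | succ j =>
        exact Finset.single_le_sum (f := fun i => a i (n - k)) (fun i _ => h.nonneg i _)
          (Finset.mem_range.2 (by omega))
    have h5 : ∑ i ∈ Finset.range (j + 1), a i (n - k) ≤ C * (3 * decay (j + 1) (μ * n)) :=
      (hsum h (n - k)).trans (by gcongr; exact h.decay_sub_le (j + 1) n hn)
    have h6 : |prev a j (n - k) - a j (n - k)| ≤ C * (3 * decay (j + 1) (μ * n)) := by
      rw [abs_le]
      constructor <;> linarith
    rw [h.recurrence j n hn, show a j n - μ * a j (n - k) + μ * prev a j (n - k) - a j n =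
      μ * (prev a j (n - k) - a j (n - k)) by ring, abs_mul, abs_of_nonneg h0]
    have h7 := mul_le_mul_of_nonneg_left h6 h0
    linarith

/-- Over a time of at most `k` steps each probability changes by `O(k μ)` times the weight. -/
lemma exists_abs_sub_le {B : ℝ} (hB : 0 ≤ B) (j : ℕ) :
    ∃ C, 0 ≤ C ∧ ∀ {μ : ℝ} {k : ℕ} {a : ℕ → ℕ → ℝ}, DelayedBirth B μ k a →
      ∀ n d : ℕ, d ≤ k →
        |a j (n + d) - a j n| ≤ C * (k * μ) * decay (j + 1) (μ * (n + d : ℕ)) := by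
  obtain ⟨C, hC, hinc⟩ := exists_increment_le hB j
  exact ⟨3 * C, by positivity, fun {μ k a} h n d hd =>
    abs_sub_le_of_increments hC h.rate_nonneg h.delay_mul_rate_le (hinc h) n d hd⟩

lemma exists_abs_prev_sub_le {B : ℝ} (hB : 0 ≤ B) (j : ℕ) :
    ∃ C, 0 ≤ C ∧ ∀ {μ : ℝ} {k : ℕ} {a : ℕ → ℕ → ℝ}, DelayedBirth B μ k a →
      ∀ n d : ℕ, d ≤ k →
        |prev a j (n + d) - prev a j n| ≤ C * (k * μ) * decay (j + 1) (μ * (n + d : ℕ)) := by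
  cases j with
  | zero => exact ⟨0, le_rfl, fun _ n d _ => by simp [prev]⟩
  | succ j =>
    obtain ⟨C, hC, hab⟩ := exists_abs_sub_le hB j
    refine ⟨C, hC, fun {μ k a} h n d hd => (hab h n d hd).trans ?_⟩
    have h0 := h.rate_nonneg
    gcongr
    exact decay_le_decay_of_le (by omega) (by positivity)

/-- Removing the delay from the recurrence costs an error `O(k μ ^ 2)` per step. -/
lemma exists_abs_step_le {B : ℝ} (hB : 0 ≤ B) (j : ℕ) :
    ∃ C, 0 ≤ C ∧ ∀ {μ : ℝ} {k : ℕ} {a : ℕ → ℕ → ℝ}, DelayedBirth B μ k a →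
      ∀ n : ℕ, k ≤ n → |a j (n + 1) - ((1 - μ) * a j n + μ * prev a j n)|
        ≤ C * (k * μ) * μ * decay (j + 1) (μ * n) := by
  obtain ⟨C₁, hC₁, h₁⟩ := exists_abs_sub_le hB j
  obtain ⟨C₂, hC₂, h₂⟩ := exists_abs_prev_sub_le hB j
  refine ⟨C₁ + C₂, by positivity, fun {μ k a} h n hn => ?_⟩
  have h0 := h.rate_nonneg
  obtain ⟨m, rfl⟩ := Nat.exists_eq_add_of_le' hn
  have h3 := h₁ h m k le_rfl
  have h4 := h₂ h m k le_rfl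
  rw [h.recurrence j _ hn, Nat.add_sub_cancel,
    show a j (m + k) - μ * a j m + μ * prev a j m -
      ((1 - μ) * a j (m + k) + μ * prev a j (m + k)) =
      μ * ((a j (m + k) - a j m) - (prev a j (m + k) - prev a j m)) by ring,
    abs_mul, abs_of_nonneg h0]
  calc _ ≤ μ * (|a j (m + k) - a j m| + |prev a j (m + k) - prev a j m|) := by
        gcongr
        exact abs_sub _ _
    _ ≤ μ * (C₁ * (k * μ) * decay (j + 1) (μ * (m + k : ℕ)) +
          C₂ * (k * μ) * decay (j + 1) (μ * (m + k : ℕ))) := by gcongr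
    _ = _ := by ring

/-- Up to time `k` both the delayed chain and the Poisson probabilities are within `O(k μ)` of
their common initial values. -/
lemma exists_abs_sub_poissonWeight_le_of_le {B : ℝ} (hB : 0 ≤ B) (j : ℕ) :
    ∃ C, 0 ≤ C ∧ ∀ {μ : ℝ} {k : ℕ} {a : ℕ → ℕ → ℝ}, DelayedBirth B μ k a →
      ∀ n : ℕ, n ≤ k →
        |a j n - poissonWeight j (μ * n)| ≤ C * (k * μ) * decay (j + 1) (μ * n) := by
  obtain ⟨C, hC, hab⟩ := exists_abs_sub_le hB j
  refine ⟨C + 3 * 2 ^ j, by positivity, fun {μ k a} h n hn => ?_⟩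
  have h0 := h.rate_nonneg
  have hn' : (n : ℝ) ≤ k := by exact_mod_cast hn
  have hd := decay_nonneg (j + 1) (t := μ * n) (by positivity)
  have h1 := hab h 0 n hn
  have hμn : μ * n ≤ k * μ := by nlinarith
  have h2 := abs_poissonWeight_sub_le j (s := 0) (t := μ * n) le_rfl (by positivity)
    (by linarith [h.delay_mul_rate_le])
  have h3 : a j 0 = poissonWeight j 0 := by
    rw [h.eq_of_lt j 0 h.pos]
    cases j <;> simp [poissonWeight]
  have h4 : decay j 0 = 1 := by simp [decay]
  rw [h4, mul_one, sub_zero] at h2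
  have h5 : 2 ^ j * (μ * n) ≤ 2 ^ j * ((k * μ) * (3 * decay (j + 1) (μ * n))) := by
    refine mul_le_mul_of_nonneg_left ?_ (by positivity)
    exact hμn.trans (le_mul_of_one_le_right (by positivity) (h.one_le_decay _ hn))
  rw [zero_add] at h1
  calc |a j n - poissonWeight j (μ * n)|
      = |(a j n - a j 0) - (poissonWeight j (μ * n) - poissonWeight j 0)| := by
        congr 1; rw [h3]; ring
    _ ≤ |a j n - a j 0| + |poissonWeight j (μ * n) - poissonWeight j 0| := abs_sub _ _
    _ ≤ _ := by linarith

/-- Nonuniform Poisson approximation for the delayed chain: the error at time `n` is at most a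
constant times `k μ` and a weight decaying exponentially in the Poisson parameter `μ n`. -/
theorem exists_abs_sub_poissonWeight_le {B : ℝ} (hB : 0 ≤ B) (j : ℕ) :
    ∃ C, 0 ≤ C ∧ ∀ {μ : ℝ} {k : ℕ} {a : ℕ → ℕ → ℝ}, DelayedBirth B μ k a →
      ∀ n : ℕ, |a j n - poissonWeight j (μ * n)| ≤ C * (k * μ) * decay (j + 2) (μ * n) := by
  -- The lower entries enter only through `prev`; the induction hypothesis is put in that form.
  have main : ∀ j, (∃ C, 0 ≤ C ∧ ∀ {μ : ℝ} {k : ℕ} {a : ℕ → ℕ → ℝ}, DelayedBirth B μ k a →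
      ∀ n : ℕ, |prev a j n - prev poissonWeight j (μ * n)|
        ≤ C * (k * μ) * decay (j + 1) (μ * n)) →
      ∃ C, 0 ≤ C ∧ ∀ {μ : ℝ} {k : ℕ} {a : ℕ → ℕ → ℝ}, DelayedBirth B μ k a →
        ∀ n : ℕ, |a j n - poissonWeight j (μ * n)| ≤ C * (k * μ) * decay (j + 2) (μ * n) := by
    rintro j ⟨C₀, hC₀, hprev⟩
    obtain ⟨C₁, hC₁, hinit⟩ := exists_abs_sub_poissonWeight_le_of_le hB j
    obtain ⟨C₂, hC₂, hstep⟩ := exists_abs_step_le hB j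
    refine ⟨C₁ + 3 * (C₀ + C₂ + 2 * 2 ^ j), by positivity, fun {μ k a} h n => ?_⟩
    have h0 := h.rate_nonneg
    obtain hn | hn := le_total n k
    · refine (hinit h n hn).trans ?_
      refine mul_le_mul ?_ (decay_le_decay_of_le (by omega) (by positivity))
        (decay_nonneg _ (by positivity)) (by positivity)
      gcongr
      exact le_add_of_nonneg_right (by positivity)
    refine (le_mul_decay_of_recurrence (D := C₁ * (k * μ))
      (K := (C₀ + C₂ + 2 * 2 ^ j) * (k * μ)) (m := j + 1)
      (u := fun n => |a j n - poissonWeight j (μ * n)|) h0 h.rate_le_one (by positivity)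
      (by positivity) (hinit h k le_rfl) (fun n hn => ?_) n hn).trans (le_of_eq (by ring))
    have h1 := hstep h n hn
    have h2 := abs_poissonWeight_step_le j (s := μ * n) (by positivity) h0 h.rate_le_one
    have h3 := mul_le_mul_of_nonneg_left (hprev h n) h0
    have h4 : 2 * 2 ^ j * decay j (μ * n) * μ ^ 2 ≤
        2 * 2 ^ j * decay (j + 1) (μ * n) * (k * μ * μ) := by
      have := decay_nonneg (j + 1) (t := μ * n) (by positivity)
      rw [sq]
      gcongr
      · exact decay_le_decay_of_le (by omega) (by positivity)
      · exact h.rate_le_delay_mul_rate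
    have hμ : μ * n + μ = μ * (n + 1 : ℕ) := by push_cast; ring
    rw [hμ] at h2
    set x := a j (n + 1)
    set y := poissonWeight j (μ * (n + 1 : ℕ))
    set d := a j n - poissonWeight j (μ * n) with hd
    set e := prev a j n - prev poissonWeight j (μ * n) with he
    set r := x - ((1 - μ) * a j n + μ * prev a j n) with hr
    set s := y - ((1 - μ) * poissonWeight j (μ * n) + μ * prev poissonWeight j (μ * n)) with hs
    calc |x - y| = |(1 - μ) * d + μ * e + r - s| := by
          congr 1; rw [hd, he, hr, hs]; ring
      _ ≤ |(1 - μ) * d| + |μ * e| + |r| + |s| :=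
          (abs_sub _ _).trans (by gcongr; exact abs_add_three _ _ _)
      _ = (1 - μ) * |d| + μ * |e| + |r| + |s| := by
          rw [abs_mul, abs_mul, abs_of_nonneg h0, abs_of_nonneg (sub_nonneg.2 h.rate_le_one)]
      _ ≤ _ := by linarith
  induction j with
  | zero => exact main 0 ⟨0, le_rfl, fun _ n => by simp [prev]⟩
  | succ j ih =>
    obtain ⟨C, hC, ih⟩ := ih
    exact main (j + 1) ⟨C, hC, fun h n => ih h n⟩

end DelayedBirth

/-! ### Maximising over the run length -/

/-- With `μ = q * p ^ k` the nonuniform bound is `O(log n / n)` for all `k` at once: it is at most a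
constant times `k / n`, because `μ n` times the weight is bounded, and at most a constant times
`k * p ^ k`. The two cases split at `k ≈ 2 log n / log (1 / p)`. -/
lemma exists_mul_decay_le {p q : ℝ} (hp0 : 0 < p) (hp1 : p < 1) (hq0 : 0 < q) (hq1 : q ≤ 1)
    (m : ℕ) :
    ∃ C, 0 ≤ C ∧ ∀ n k : ℕ, 3 ≤ n →
      k * (q * p ^ k) * decay m (q * p ^ k * n) ≤ C * ((n : ℝ)⁻¹ * Real.log n) := by
  set l := -Real.log p with hl
  have hl0 : 0 < l := neg_pos.2 (Real.log_neg hp0 hp1)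
  have hpk : ∀ k : ℕ, p ^ k = Real.exp (-(l * k)) := fun k => by
    rw [hl, ← Real.exp_log hp0, ← Real.exp_nat_mul, Real.exp_log hp0]
    ring_nf
  refine ⟨2 / l * (3 * (m + 1).factorial), by positivity, fun n k hn => ?_⟩
  have hn0 : (0 : ℝ) < n := by positivity
  have hlog : 1 ≤ Real.log n := by
    rw [Real.le_log_iff_exp_le hn0]
    exact exp_one_le_three.trans (by exact_mod_cast hn)
  set μ := q * p ^ k with hμ
  have hμ0 : 0 ≤ μ := by positivity
  have hd0 := decay_nonneg m (t := μ * n) (by positivity)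
  obtain hk | hk := le_total (l * k / 2) (Real.log n)
  · have h1 : μ * n * decay m (μ * n) ≤ 3 * (m + 1).factorial := by
      refine le_trans ?_ (decay_le_factorial (m + 1) (t := μ * n) (by positivity))
      calc μ * n * decay m (μ * n) ≤ (1 + μ * n) * decay m (μ * n) := by gcongr; linarith
        _ = decay (m + 1) (μ * n) := by unfold decay; ring
    have h2 : (k : ℝ) ≤ 2 / l * Real.log n := by
      rw [div_mul_eq_mul_div, le_div_iff₀ hl0]
      linarith
    calc k * μ * decay m (μ * n) = k * (n : ℝ)⁻¹ * (μ * n * decay m (μ * n)) := by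
          field_simp
      _ ≤ (2 / l * Real.log n) * (n : ℝ)⁻¹ * (3 * (m + 1).factorial) := by gcongr
      _ = _ := by ring
  · have h1 : decay m (μ * n) ≤ 3 * (m + 1).factorial :=
      (decay_le_factorial m (by positivity)).trans (by gcongr; omega)
    -- Half of the exponent `l k` absorbs the factor `k`, the other half is at least `log n`.
    have h2 : k * p ^ k ≤ 2 / l * (n : ℝ)⁻¹ := by
      have h3 : l * k / 2 ≤ Real.exp (l * k / 2) := by linarith [Real.add_one_le_exp (l * k / 2)]
      have h4 : Real.exp (-(l * k / 2)) ≤ (n : ℝ)⁻¹ := by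
        rw [← Real.exp_log (inv_pos.2 hn0), Real.log_inv]
        exact Real.exp_le_exp.2 (by linarith)
      calc k * p ^ k = 2 / l * (l * k / 2 * Real.exp (-(l * k))) := by rw [hpk]; field_simp
        _ ≤ 2 / l * (Real.exp (l * k / 2) * Real.exp (-(l * k))) := by gcongr
        _ = 2 / l * Real.exp (-(l * k / 2)) := by rw [← Real.exp_add]; ring_nf
        _ ≤ 2 / l * (n : ℝ)⁻¹ := by gcongr
    calc k * μ * decay m (μ * n) = q * (k * p ^ k) * decay m (μ * n) := by rw [hμ]; ring
      _ ≤ 1 * (2 / l * (n : ℝ)⁻¹) * (3 * (m + 1).factorial) := by gcongr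
      _ ≤ 1 * (2 / l * (n : ℝ)⁻¹) * (3 * (m + 1).factorial) * Real.log n :=
          le_mul_of_one_le_right (by positivity) hlog
      _ = _ := by ring

/-! ### Counting head runs pathwise -/

section Pathwise

variable {Ω Ω' : Type*}

lemma numHeadRuns_of_lt (ξ : ℕ → Ω → ℕ) {n k : ℕ} (h : n < k) (ω : Ω) :
    numHeadRuns ξ n k ω = 0 := by
  simp [numHeadRuns, Nat.sub_eq_zero_of_le (Nat.succ_le_of_lt h)]

lemma numHeadRuns_succ (ξ : ℕ → Ω → ℕ) {n k : ℕ} (h : k ≤ n + 1) (ω : Ω) :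
    numHeadRuns ξ (n + 1) k ω =
      numHeadRuns ξ n k ω + (headRunEvent ξ k (n + 1 - k)).indicator (fun _ => 1) ω := by
  unfold numHeadRuns
  rw [Nat.succ_sub h, Finset.sum_range_succ]

lemma numHeadRuns_le_succ (ξ : ℕ → Ω → ℕ) (n k : ℕ) (ω : Ω) :
    numHeadRuns ξ n k ω ≤ numHeadRuns ξ (n + 1) k ω :=
  Finset.sum_le_sum_of_subset (Finset.range_mono (by omega))

/-- If a run reaches length `k` at time `n + 1`, it is preceded by a zero at position `n + 1 - k`,
so that no other run of length `k` can reach that length between the times `n - k` and `n`. -/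
lemma numHeadRuns_sub_eq (ξ : ℕ → Ω → ℕ) {n k : ℕ} (h : k ≤ n) {ω : Ω}
    (hω : ω ∈ headRunEvent ξ k (n + 1 - k)) :
    numHeadRuns ξ (n - k) k ω = numHeadRuns ξ n k ω := by
  refine Finset.sum_subset (Finset.range_mono (by omega)) fun l hl hl' => ?_
  rw [Finset.mem_range] at hl hl'
  refine Set.indicator_of_notMem (fun hmem => ?_) _
  have h0 := hω.1 (by omega)
  have h1 := hmem.2 (n + 1 - k - l) (Finset.mem_Icc.2 (by omega))
  rw [Nat.add_sub_cancel' hl.le, h0] at h1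
  exact zero_ne_one h1

lemma numHeadRuns_congr {ξ : ℕ → Ω → ℕ} {η : ℕ → Ω' → ℕ} {n k : ℕ} {ω : Ω} {ω' : Ω'}
    (h : ∀ i, 1 ≤ i → i ≤ n → ξ i ω = η i ω') : numHeadRuns ξ n k ω = numHeadRuns η n k ω' := by
  classical
  refine Finset.sum_congr rfl fun l hl => ?_
  rw [Finset.mem_range] at hl
  have hiff : ω ∈ headRunEvent ξ k l ↔ ω' ∈ headRunEvent η k l := by
    refine and_congr (imp_congr_right fun hl1 => ?_) (forall₂_congr fun m hm => ?_)
    · rw [h l hl1 (by omega)]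
    · rw [Finset.mem_Icc] at hm
      rw [h (l + m) (by omega) (by omega)]
  simp only [Set.indicator_apply, hiff]

lemma exists_numHeadRuns_eq (ξ : ℕ → Ω → ℕ) (n k : ℕ) :
    ∃ F : (Finset.range n → ℕ) → ℕ, ∀ ω, numHeadRuns ξ n k ω = F fun i => ξ (i + 1) ω := by
  refine ⟨fun x => numHeadRuns (fun i (x : Finset.range n → ℕ) =>
    if h : i - 1 ∈ Finset.range n then x ⟨i - 1, h⟩ else 0) n k x, fun ω => ?_⟩
  refine numHeadRuns_congr fun i hi hin => ?_
  rw [dif_pos (Finset.mem_range.2 (by omega))]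
  simp only [Nat.sub_add_cancel hi]

lemma headRunEvent_zero_eq (ξ : ℕ → Ω → ℕ) (k : ℕ) :
    headRunEvent ξ k 0 = ⋂ i ∈ Finset.range k, ξ (i + 1) ⁻¹' {1} := by
  ext ω
  simp only [headRunEvent, Set.mem_ofPred_eq, Set.mem_iInter, Set.mem_preimage,
    Set.mem_singleton_iff, Finset.mem_range, Finset.mem_Icc]
  constructor
  · intro h i hi
    simpa [add_comm] using h.2 (i + 1) (by omega)
  · refine fun h => ⟨by simp, fun m hm => ?_⟩
    have := h (m - 1) (by omega)
    rwa [Nat.sub_add_cancel hm.1, ← zero_add m] at this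

lemma headRunEvent_succ_eq (ξ : ℕ → Ω → ℕ) (k i : ℕ) :
    headRunEvent ξ k (i + 1) =
      ⋂ l ∈ Finset.Ico i (i + k + 1), ξ (l + 1) ⁻¹' {if l = i then 0 else 1} := by
  ext ω
  simp only [headRunEvent, Set.mem_ofPred_eq, Set.mem_iInter, Set.mem_preimage,
    Set.mem_singleton_iff, Finset.mem_Ico, Finset.mem_Icc]
  constructor
  · intro h l hl
    split_ifs with hli
    · exact hli ▸ h.1 (by omega)
    · have := h.2 (l - i) (by omega)
      rwa [show i + 1 + (l - i) = l + 1 by omega] at this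
  · refine fun h => ⟨fun _ => ?_, fun m hm => ?_⟩
    · simpa using h i (by omega)
    · have := h (i + m) (by omega)
      rw [if_neg (by omega)] at this
      rwa [show i + 1 + m = i + m + 1 by omega]

end Pathwise

/-! ### The law of the number of head runs -/

section Law

variable {Ω : Type*} [MeasurableSpace Ω] {P : Measure Ω}
  {p : unitInterval} {ξ : ℕ → Ω → ℕ}

lemma measureReal_preimage_one (hlaw : ∀ i : ℕ, 1 ≤ i → HasLaw (ξ i) (bernoulliMeasure 1 0 p) P)
    (i : ℕ) : P.real (ξ (i + 1) ⁻¹' {1}) = p := by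
  rw [← map_measureReal_apply_of_aemeasurable (hlaw _ i.succ_pos).aemeasurable
    (measurableSet_singleton _), (hlaw _ i.succ_pos).map_eq]
  simp

lemma measureReal_preimage_zero (hlaw : ∀ i : ℕ, 1 ≤ i → HasLaw (ξ i) (bernoulliMeasure 1 0 p) P)
    (i : ℕ) : P.real (ξ (i + 1) ⁻¹' {0}) = 1 - p := by
  rw [← map_measureReal_apply_of_aemeasurable (hlaw _ i.succ_pos).aemeasurable
    (measurableSet_singleton _), (hlaw _ i.succ_pos).map_eq]
  simp

lemma measureReal_biInter_preimage (hindep : iIndepFun (fun i : ℕ => ξ (i + 1)) P)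
    (S : Finset ℕ) (c : ℕ → ℕ) :
    P.real (⋂ i ∈ S, ξ (i + 1) ⁻¹' {c i}) = ∏ i ∈ S, P.real (ξ (i + 1) ⁻¹' {c i}) := by
  simp only [measureReal_def]
  rw [hindep.measure_inter_preimage_eq_mul S fun i _ => measurableSet_singleton (c i),
    ENNReal.toReal_prod]

lemma measureReal_headRunEvent_zero (hindep : iIndepFun (fun i : ℕ => ξ (i + 1)) P)
    (hlaw : ∀ i : ℕ, 1 ≤ i → HasLaw (ξ i) (bernoulliMeasure 1 0 p) P) (k : ℕ) :
    P.real (headRunEvent ξ k 0) = (p : ℝ) ^ k := by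
  rw [headRunEvent_zero_eq, measureReal_biInter_preimage hindep _ fun _ => 1]
  simp [measureReal_preimage_one hlaw]

lemma measureReal_headRunEvent_succ (hindep : iIndepFun (fun i : ℕ => ξ (i + 1)) P)
    (hlaw : ∀ i : ℕ, 1 ≤ i → HasLaw (ξ i) (bernoulliMeasure 1 0 p) P) (k i : ℕ) :
    P.real (headRunEvent ξ k (i + 1)) = (1 - p) * (p : ℝ) ^ k := by
  rw [headRunEvent_succ_eq, measureReal_biInter_preimage hindep _ fun l => if l = i then 0 else 1,
    Finset.prod_eq_prod_Ico_succ_bot (by omega), if_pos rfl, measureReal_preimage_zero hlaw,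
    Finset.prod_congr rfl fun l hl => ?_, Finset.prod_const, Nat.card_Ico]
  · congr 2
    omega
  · rw [if_neg (by have := (Finset.mem_Ico.1 hl).1; omega), measureReal_preimage_one hlaw]

lemma nullMeasurableSet_headRunEvent
    (hlaw : ∀ i : ℕ, 1 ≤ i → HasLaw (ξ i) (bernoulliMeasure 1 0 p) P) (k i : ℕ) :
    NullMeasurableSet (headRunEvent ξ k i) P := by
  have h : ∀ l c, NullMeasurableSet (ξ (l + 1) ⁻¹' {c}) P := fun l c =>
    (hlaw _ l.succ_pos).aemeasurable.nullMeasurableSet_preimage (measurableSet_singleton c)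
  cases i with
  | zero =>
    rw [headRunEvent_zero_eq]
    exact Finset.nullMeasurableSet_biInter _ fun l _ => h l _
  | succ i =>
    rw [headRunEvent_succ_eq]
    exact Finset.nullMeasurableSet_biInter _ fun l _ => h l _

lemma aemeasurable_numHeadRuns
    (hlaw : ∀ i : ℕ, 1 ≤ i → HasLaw (ξ i) (bernoulliMeasure 1 0 p) P) (n k : ℕ) :
    AEMeasurable (numHeadRuns ξ n k) P := by
  obtain ⟨F, hF⟩ := exists_numHeadRuns_eq ξ n k
  rw [show numHeadRuns ξ n k = F ∘ fun ω i => ξ (i + 1) ω from funext hF]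
  exact (Measurable.of_discrete (f := F)).comp_aemeasurable
    (aemeasurable_pi_lambda _ fun i => (hlaw _ (i : ℕ).succ_pos).aemeasurable)

/-- A run reaching length `k` at time `n + 1` involves only the trials after time `n - k`. -/
lemma measureReal_numHeadRuns_inter (hindep : iIndepFun (fun i : ℕ => ξ (i + 1)) P)
    (hlaw : ∀ i : ℕ, 1 ≤ i → HasLaw (ξ i) (bernoulliMeasure 1 0 p) P) {n k : ℕ} (h : k ≤ n)
    (j : ℕ) :
    P.real ({ω | numHeadRuns ξ (n - k) k ω = j} ∩ headRunEvent ξ k (n + 1 - k)) =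
      (1 - p) * (p : ℝ) ^ k * P.real {ω | numHeadRuns ξ (n - k) k ω = j} := by
  obtain ⟨m, rfl⟩ := Nat.exists_eq_add_of_le' h
  rw [show m + k + 1 - k = m + 1 by omega, Nat.add_sub_cancel,
    ← measureReal_headRunEvent_succ hindep hlaw k m]
  obtain ⟨F, hF⟩ := exists_numHeadRuns_eq ξ m k
  have hW : {ω | numHeadRuns ξ m k ω = j} =
      (fun ω (i : Finset.range m) => ξ (i + 1) ω) ⁻¹' (F ⁻¹' {j}) := by
    ext ω
    simp [hF]
  have hA : headRunEvent ξ k (m + 1) =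
      (fun ω (i : Finset.Ico m (m + k + 1)) => ξ (i + 1) ω) ⁻¹'
        {x | ∀ i, x i = if (i : ℕ) = m then 0 else 1} := by
    rw [headRunEvent_succ_eq]
    ext ω
    simp
  have hdisj : Disjoint (Finset.range m) (Finset.Ico m (m + k + 1)) := by
    rw [Finset.range_eq_Ico]
    exact Finset.Ico_disjoint_Ico_consecutive 0 m _
  have hind := hindep.indepFun_finset₀ _ _ hdisj fun i => (hlaw _ i.succ_pos).aemeasurable
  rw [hW, hA, measureReal_def, hind.measure_inter_preimage_eq_mul _ _ .of_discrete .of_discrete,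
    ENNReal.toReal_mul, mul_comm]
  rfl

lemma sum_measureReal_numHeadRuns [IsProbabilityMeasure P]
    (hlaw : ∀ i : ℕ, 1 ≤ i → HasLaw (ξ i) (bernoulliMeasure 1 0 p) P) (n k J : ℕ) :
    ∑ j ∈ Finset.range J, P.real {ω | numHeadRuns ξ n k ω = j} =
      P.real {ω | numHeadRuns ξ n k ω < J} := by
  have hW := aemeasurable_numHeadRuns hlaw n k
  have := Measure.isProbabilityMeasure_map hW
  have h : ∀ s : Set ℕ, P.real (numHeadRuns ξ n k ⁻¹' s) = (P.map (numHeadRuns ξ n k)).real s :=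
    fun s => (map_measureReal_apply_of_aemeasurable hW .of_discrete).symm
  calc _ = ∑ j ∈ Finset.range J, (P.map (numHeadRuns ξ n k)).real {j} :=
        Finset.sum_congr rfl fun j _ => h {j}
    _ = P.real (numHeadRuns ξ n k ⁻¹' (Finset.range J : Set ℕ)) := by
        rw [sum_measureReal_singleton, h]
    _ = _ := by congr 1; ext ω; simp

/-- The numbers of head runs of length at least `k` among the first `n` trials form a delayed
birth chain in `n`. -/
theorem delayedBirth_numHeadRuns [IsProbabilityMeasure P] (hp1 : p < 1)
    (hindep : iIndepFun (fun i : ℕ => ξ (i + 1)) P)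
    (hlaw : ∀ i : ℕ, 1 ≤ i → HasLaw (ξ i) (bernoulliMeasure 1 0 p) P) {k : ℕ} (hk : 1 ≤ k) :
    DelayedBirth (1 - p : ℝ)⁻¹ ((1 - p) * (p : ℝ) ^ k) k
      fun j n => P.real {ω | numHeadRuns ξ n k ω = j} := by
  have hp0' : (0 : ℝ) ≤ p := p.2.1
  have hp1' : (p : ℝ) < 1 := hp1
  have hmeas := nullMeasurableSet_headRunEvent hlaw k
  -- Off the event that a run reaches length `k` at time `n + 1`, the count does not change.
  have hdiff : ∀ n j, k ≤ n + 1 →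
      {ω | numHeadRuns ξ (n + 1) k ω = j} \ headRunEvent ξ k (n + 1 - k) =
        {ω | numHeadRuns ξ n k ω = j} \ headRunEvent ξ k (n + 1 - k) := by
    intro n j hn
    ext ω
    refine and_congr_left fun hω => ?_
    simp only [Set.mem_ofPred_eq]
    rw [numHeadRuns_succ ξ hn, Set.indicator_of_notMem hω, add_zero]
  have hsplit : ∀ n i j, P.real ({ω | numHeadRuns ξ n k ω = j} ∩ headRunEvent ξ k i) +
      P.real ({ω | numHeadRuns ξ n k ω = j} \ headRunEvent ξ k i) =
        P.real {ω | numHeadRuns ξ n k ω = j} := fun n i j =>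
    measureReal_inter_add_sdiff₀ (hmeas i)
  refine ⟨fun j n => measureReal_nonneg, fun j n hn => ?_, fun j n hn => ?_, fun j n hn => ?_,
    fun J => antitone_nat_of_succ_le fun n => ?_, fun J n => ?_, hk, by
      have : 0 ≤ 1 - (p : ℝ) := by linarith
      positivity, ?_⟩
  · simp only [numHeadRuns_of_lt ξ hn]
    cases j <;> simp
  · have h1 := hsplit (n + 1) (n + 1 - k) j
    have h2 := hsplit n (n + 1 - k) j
    rw [hdiff n j hn.ge] at h1
    have hA : P.real (headRunEvent ξ k (n + 1 - k)) = (p : ℝ) ^ k := by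
      rw [hn, Nat.sub_self, measureReal_headRunEvent_zero hindep hlaw]
    have h3 : ∀ s : Set Ω, P.real (s ∩ headRunEvent ξ k (n + 1 - k)) ≤ (p : ℝ) ^ k :=
      fun s => (measureReal_mono Set.inter_subset_right).trans hA.le
    have h4 : ∀ s : Set Ω, 0 ≤ P.real (s ∩ headRunEvent ξ k (n + 1 - k)) :=
      fun s => measureReal_nonneg
    have hq : (1 - p : ℝ) ≠ 0 := by linarith
    rw [inv_mul_cancel_left₀ hq, abs_le]
    constructor <;>
      linarith [h3 {ω | numHeadRuns ξ (n + 1) k ω = j}, h3 {ω | numHeadRuns ξ n k ω = j},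
        h4 {ω | numHeadRuns ξ (n + 1) k ω = j}, h4 {ω | numHeadRuns ξ n k ω = j}]
  · have h1 := hsplit (n + 1) (n + 1 - k) j
    have h2 := hsplit n (n + 1 - k) j
    have h3 := measureReal_numHeadRuns_inter hindep hlaw hn
    rw [hdiff n j (by omega)] at h1
    have h4 : {ω | numHeadRuns ξ n k ω = j} ∩ headRunEvent ξ k (n + 1 - k) =
        {ω | numHeadRuns ξ (n - k) k ω = j} ∩ headRunEvent ξ k (n + 1 - k) := by
      ext ω
      refine and_congr_left fun hω => ?_
      simp only [Set.mem_ofPred_eq, numHeadRuns_sub_eq ξ hn hω]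
    have h5 : P.real ({ω | numHeadRuns ξ (n + 1) k ω = j} ∩ headRunEvent ξ k (n + 1 - k)) =
        (1 - p) * (p : ℝ) ^ k *
          prev (fun j n => P.real {ω | numHeadRuns ξ n k ω = j}) j (n - k) := by
      have hsucc : ∀ ω ∈ headRunEvent ξ k (n + 1 - k),
          numHeadRuns ξ (n + 1) k ω = numHeadRuns ξ (n - k) k ω + 1 := fun ω hω => by
        rw [numHeadRuns_succ ξ (by omega), Set.indicator_of_mem hω, numHeadRuns_sub_eq ξ hn hω]
      cases j with
      | zero =>
        rw [prev, mul_zero, Set.eq_empty_of_forall_notMem (s := _ ∩ _), measureReal_empty]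
        rintro ω ⟨hω0, hω⟩
        exact Nat.succ_ne_zero _ ((hsucc ω hω).symm.trans hω0)
      | succ j =>
        rw [prev, ← h3 j]
        congr 1
        ext ω
        refine and_congr_left fun hω => ?_
        simp only [Set.mem_ofPred_eq]
        rw [hsucc ω hω, Nat.add_right_cancel_iff]
    rw [h4, h3 j] at h2
    rw [h5] at h1
    linarith
  · rw [sum_measureReal_numHeadRuns hlaw, sum_measureReal_numHeadRuns hlaw]
    exact measureReal_mono fun ω hω => (numHeadRuns_le_succ ξ n k ω).trans_lt hω
  · rw [sum_measureReal_numHeadRuns hlaw]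
    exact measureReal_le_one
  · -- `k (1 - p) p ^ k ≤ (1 - p) (1 + p + ⋯ + p ^ (k - 1)) = 1 - p ^ k`.
    have h1 : (k : ℝ) * (p : ℝ) ^ k ≤ ∑ i ∈ Finset.range k, (p : ℝ) ^ i := by
      rw [← nsmul_eq_mul]
      conv_lhs => rw [← Finset.card_range k]
      exact Finset.card_nsmul_le_sum _ _ _ fun i hi =>
        pow_le_pow_of_le_one hp0' hp1'.le (by simpa using (Finset.mem_range.1 hi).le)
    have h2 := mul_neg_geom_sum (p : ℝ) k
    have h3 := mul_le_mul_of_nonneg_left h1 (sub_nonneg.2 hp1'.le)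
    have h4 : 0 ≤ (p : ℝ) ^ k := by positivity
    linarith

end Law

theorem corollary16 {Ω : Type*} [MeasurableSpace Ω] (P : Measure Ω) [IsProbabilityMeasure P]
    (p : unitInterval) (hp0 : 0 < p) (hp1 : p < 1)
    (ξ : ℕ → Ω → ℕ)
    (hindep : iIndepFun (fun i : ℕ => ξ (i + 1)) P)
    (hlaw : ∀ i : ℕ, 1 ≤ i → HasLaw (ξ i) (bernoulliMeasure 1 0 p) P)
    (j : ℕ) :
    (fun n : ℕ => ⨆ k : Finset.Icc 1 n,
        |P.real {ω | numHeadRuns ξ n k ω = j} - (poissonMeasure (headRunRate p n k)).real {j}|)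
      =O[atTop] fun n : ℕ => (n : ℝ)⁻¹ * Real.log n := by
  have hp0' : (0 : ℝ) < p := hp0
  have hp1' : (p : ℝ) < 1 := hp1
  have hq0 : 0 < 1 - (p : ℝ) := sub_pos.2 hp1'
  obtain ⟨C₁, hC₁, h₁⟩ := DelayedBirth.exists_abs_sub_poissonWeight_le (inv_nonneg.2 hq0.le) j
  obtain ⟨C₂, hC₂, h₂⟩ := exists_mul_decay_le hp0' hp1' hq0 (by linarith) (j + 2)
  refine IsBigO.of_bound (C₁ * C₂) ?_
  filter_upwards [eventually_ge_atTop 3] with n hn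
  have hlog : 0 ≤ (n : ℝ)⁻¹ * Real.log n :=
    mul_nonneg (by positivity) (Real.log_natCast_nonneg n)
  rw [Real.norm_of_nonneg (Real.iSup_nonneg fun k => abs_nonneg _), Real.norm_of_nonneg hlog]
  refine Real.iSup_le (fun ⟨k, hk⟩ => ?_) (by positivity)
  have hpois : (poissonMeasure (headRunRate p n k)).real {j} =
      poissonWeight j ((1 - p) * (p : ℝ) ^ k * n) := by
    have hrate : (headRunRate p n k : ℝ) = (1 - p) * (p : ℝ) ^ k * n := by
      change (n : ℝ) * (1 - (p : ℝ)) * (p : ℝ) ^ k = _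
      ring
    rw [poissonMeasure_real_singleton, hrate, poissonWeight]
  rw [hpois]
  calc _ ≤ C₁ * (k * ((1 - p) * (p : ℝ) ^ k)) * decay (j + 2) ((1 - p) * (p : ℝ) ^ k * n) :=
        h₁ (delayedBirth_numHeadRuns hp1 hindep hlaw (Finset.mem_Icc.1 hk).1) n
    _ = C₁ * (k * ((1 - p) * (p : ℝ) ^ k) * decay (j + 2) ((1 - p) * (p : ℝ) ^ k * n)) := by ring
    _ ≤ C₁ * (C₂ * ((n : ℝ)⁻¹ * Real.log n)) := mul_le_mul_of_nonneg_left (h₂ n k hn) hC₁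
    _ = _ := by ring
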